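/- For a finite simple graph $G$ and an integer $k\ge 1$, let $G^k$ be the strong product of $k$ copies of $G$ (its vertices are the words of length $k$ over $V(G)$, and two distinct words are adjacent if and only if, in each coordinate, their letters are equal or adjacent in $G$). Let $\alpha(G^k)$ be its independence number and $a_k=a_k(G)=\alpha(G^k)^{1/k}$; the sequence $(a_k)_{k\ge1}$ is the independence series of $G$. For all positive integers $\nu_1<\dots<\nu_s$ and every real $\varepsilon>0$ there exists a finite graph $G$ such that, for every $i\in\{1,\dots,s\}$ and every integer $k$ with $1\le k<\nu_i$, $$a_k<a_{\nu_i}^{\varepsilon}.$$ -/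

import Mathlib

namespace SimpleGraph

/-- The strong product of two graphs: two distinct vertices are adjacent iff in each coordinate
they are equal or adjacent. -/
def strongProd {V W : Type*} (G : SimpleGraph V) (H : SimpleGraph W) : SimpleGraph (V × W) where
  Adj u v := u ≠ v ∧ (u.1 = v.1 ∨ G.Adj u.1 v.1) ∧ (u.2 = v.2 ∨ H.Adj u.2 v.2)
  symm := ⟨fun _ _ h => ⟨h.1.symm, h.2.1.imp Eq.symm (fun a => a.symm),
    h.2.2.imp Eq.symm (fun a => a.symm)⟩⟩
  loopless := ⟨fun _ h => h.1 rfl⟩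

/-- The strong product of `k` copies of `G`, on words of length `k`: two distinct words are
adjacent iff in each coordinate they are equal or adjacent. -/
def strongPow {V : Type*} (G : SimpleGraph V) (k : ℕ) : SimpleGraph (Fin k → V) where
  Adj u v := u ≠ v ∧ ∀ i, u i = v i ∨ G.Adj (u i) (v i)
  symm := ⟨fun _ _ h => ⟨h.1.symm, fun i => (h.2 i).imp Eq.symm (fun a => a.symm)⟩⟩
  loopless := ⟨fun _ h => h.1 rfl⟩

/-- The power with exponent `1` is `G`. -/
def strongPowOneIso {V : Type*} (G : SimpleGraph V) : G.strongPow 1 ≃g G where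
  toEquiv := Equiv.funUnique (Fin 1) V
  map_rel_iff' := by
    intro u v
    simp only [strongPow, Equiv.funUnique_apply, Fin.default_eq_zero, ne_eq, funext_iff,
      Fin.forall_fin_one]
    constructor
    · exact fun h => ⟨h.ne, Or.inr h⟩
    · rintro ⟨h, h' | h'⟩
      · exact absurd h' h
      · exact h'

/-- The power with exponent `k + 1` is the strong product of `G` and the power with exponent `k`. -/
def strongPowSuccIso {V : Type*} (G : SimpleGraph V) (k : ℕ) :
    G.strongPow (k + 1) ≃g G.strongProd (G.strongPow k) where
  toEquiv := (Fin.consEquiv (fun _ : Fin (k + 1) => V)).symm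
  map_rel_iff' := by
    intro u v
    have h : (u = v) ↔ u 0 = v 0 ∧ Fin.tail u = Fin.tail v := by
      simp [funext_iff, Fin.forall_fin_succ, Fin.tail]
    have h2 : (Fin.tail u = Fin.tail v) ↔ ∀ i : Fin k, u i.succ = v i.succ := by
      simp [funext_iff, Fin.tail]
    simp only [strongProd, strongPow, Fin.consEquiv, Equiv.coe_fn_symm_mk, Prod.mk.injEq, ne_eq,
      h, h2, Fin.forall_fin_succ, Fin.tail]
    constructor
    · rintro ⟨a, b, c | c⟩
      · exact ⟨a, b, fun i => Or.inl (c i)⟩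
      · exact ⟨a, b, c.2⟩
    · rintro ⟨a, b, c⟩
      refine ⟨a, b, ?_⟩
      by_cases e : ∀ i : Fin k, u i.succ = v i.succ
      · exact Or.inl e
      · exact Or.inr ⟨e, c⟩

/-- The `k`-th term (for `k ≥ 1`) of the independence series of a finite graph `G`: the `k`-th root
of the independence number of the `k`-th strong power of `G`. -/
noncomputable def indepSeries {V : Type*} (G : SimpleGraph V) (k : ℕ) : ℝ :=
  ((G.strongPow k).indepNum : ℝ) ^ ((1 : ℝ) / (k : ℝ))

end SimpleGraph

/-! Fix a colouring of the pairs of letters with `B` colours. Layer `j` has `B` copies of an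
alphabet of `n ^ d ^ (j + 1)` letters; copy `t` joins all pairs except those of truncated colour
`t`, and distinct copies are fully joined. Exponent `ν j` suffices for a large independent set:
write each letter once in each of the copies `0, ..., ν j - 1`; the colour of two letters names a
copy where they are non-adjacent. For `k < ν i` some colour `t₀ < ν i` is missed by the copies in a
word. Once layers, copies and all letters from layers below `i` are fixed, independent words
pairwise differ in a coordinate of colour other than `t₀`. For a random colouring such families have
at most `n` words (`exists_coloring_forall_letterDisjoint`, `card_le_of_forall_letterDisjoint`).
Hence `α(G^k)` is at most `n ^ (3 * B * d ^ i)`, against `n ^ d ^ (i + 1)` at exponent `ν i`; a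
large `d` wins. -/

/-! ### Random colourings and the union bound -/

open Finset in
/-- If the sets `F q`, `q ∈ Q`, are pairwise disjoint of size at most `K`, then a random colouring
makes none of them monochromatic of colour `t` with probability at most
`(1 - |C|⁻ᴷ) ^ |Q|`. -/
theorem card_filter_forall_exists_ne_le {E C ι : Type*} [Fintype E] [DecidableEq E] [Fintype C]
    [DecidableEq C] [DecidableEq ι] (t : C) (F : ι → Finset E) (K : ℕ) (Q : Finset ι)
    (hcard : ∀ q ∈ Q, #(F q) ≤ K)
    (hdisj : ∀ q ∈ Q, ∀ q' ∈ Q, q ≠ q' → Disjoint (F q) (F q')) :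
    (#{f : E → C | ∀ q ∈ Q, ∃ e ∈ F q, f e ≠ t} : ℝ) ≤
      (1 - ((Fintype.card C : ℝ) ^ K)⁻¹) ^ #Q * (Fintype.card C : ℝ) ^ Fintype.card E := by
  have hC : 0 < Fintype.card C := Fintype.card_pos_iff.2 ⟨t⟩
  have hC1 : (1 : ℝ) ≤ (Fintype.card C : ℝ) ^ K := one_le_pow₀ (by exact_mod_cast hC)
  induction Q using Finset.induction_on with
  | empty => simp [Fintype.card_pi]
  | insert q Q hq ih =>
    set A : Finset (E → C) := {f | ∀ q ∈ Q, ∃ e ∈ F q, f e ≠ t} with hA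
    set D : Finset (E → C) := {f ∈ A | ∀ e ∈ F q, f e = t} with hD
    have hsplit : ({f : E → C | ∀ q' ∈ insert q Q, ∃ e ∈ F q', f e ≠ t} : Finset _) = A \ D := by
      ext f
      simp only [hA, hD, mem_filter, mem_univ, true_and, mem_sdiff, forall_mem_insert]
      constructor
      · rintro ⟨⟨e, he, hne⟩, h⟩
        exact ⟨h, fun h' => hne (h'.2 e he)⟩
      · rintro ⟨h, h'⟩
        refine ⟨?_, h⟩
        by_contra! h2
        exact h' ⟨h, h2⟩
    have hDA : D ⊆ A := filter_subset _ _
    -- Recolouring `F q` by `t` maps `A` into `D`, as the other sets `F q'` are untouched; a fibre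
    -- is determined by the values on `F q`.
    have hle : #A ≤ Fintype.card C ^ K * #D := by
      refine card_le_mul_card_image_of_maps_to
        (f := fun f e => if e ∈ F q then t else f e) ?_ _ ?_
      · intro f hf
        simp only [hA, hD, mem_filter, mem_univ, true_and] at hf ⊢
        refine ⟨fun q' hq' => ?_, fun e he => by simp [he]⟩
        obtain ⟨e, he, hne⟩ := hf q' hq'
        have hd := hdisj q (mem_insert_self _ _) q' (mem_insert_of_mem hq')
          (fun h => hq (h ▸ hq'))
        exact ⟨e, he, by rwa [if_neg (disjoint_right.1 hd he)]⟩
      · intro b _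
        calc #{f ∈ A | (fun e => if e ∈ F q then t else f e) = b}
            ≤ #(univ : Finset (F q → C)) := by
              refine card_le_card_of_injOn (fun f e => f e) (fun _ _ => by simp) ?_
              intro f hf g hg hfg
              simp only [coe_filter, Set.mem_ofPred_eq] at hf hg
              funext e
              by_cases he : e ∈ F q
              · exact congrFun hfg ⟨e, he⟩
              · have := congrFun (hf.2.trans hg.2.symm) e
                simpa [he] using this
          _ = Fintype.card C ^ #(F q) := by simp
          _ ≤ Fintype.card C ^ K :=
              Nat.pow_le_pow_right hC (hcard q (mem_insert_self _ _))
    have ih' := ih (fun q' hq' => hcard q' (mem_insert_of_mem hq'))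
      (fun a ha b hb => hdisj a (mem_insert_of_mem ha) b (mem_insert_of_mem hb))
    rw [hsplit, card_sdiff_of_subset hDA, Nat.cast_sub (card_le_card hDA), card_insert_of_notMem hq]
    have hle' : (#A : ℝ) ≤ (Fintype.card C : ℝ) ^ K * #D := by exact_mod_cast hle
    have h1 : ((Fintype.card C : ℝ) ^ K)⁻¹ * #A ≤ #D := by
      rw [inv_mul_le_iff₀ (by linarith)]
      exact hle'
    have h2 : 0 ≤ 1 - ((Fintype.card C : ℝ) ^ K)⁻¹ := sub_nonneg.2 (inv_le_one_of_one_le₀ hC1)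
    calc (#A : ℝ) - #D ≤ (1 - ((Fintype.card C : ℝ) ^ K)⁻¹) * #A := by linarith
      _ ≤ (1 - ((Fintype.card C : ℝ) ^ K)⁻¹) * _ := mul_le_mul_of_nonneg_left ih' h2
      _ = _ := by ring

/-- No letter occurs in two different words of the two families `u` and `v`. -/
def LetterDisjoint {ι κ V : Type*} (u v : ι → κ → V) : Prop :=
  (∀ x x' l l', u x l = u x' l' → x = x') ∧ (∀ y y' l l', v y l = v y' l' → y = y') ∧
    ∀ x y l l', u x l ≠ v y l'

open Finset in
/-- There is a colouring of the pairs for which any two families of `m` words, no two of them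
sharing a letter, contain two words joined in colour `t` in every coordinate. -/
theorem exists_coloring_forall_letterDisjoint {V C : Type*} [Fintype V] [DecidableEq V]
    [Fintype C] [DecidableEq C] [Nonempty C] (m K : ℕ)
    (h : (Fintype.card C : ℝ) * (Fintype.card V : ℝ) ^ (2 * K * m) *
      (1 - ((Fintype.card C : ℝ) ^ K)⁻¹) ^ (m * m) < 1) :
    ∃ c : Sym2 V → C, ∀ t, ∀ u v : Fin m → Fin K → V, LetterDisjoint u v →
      ∃ x y, ∀ l, c s(u x l, v y l) = t := by
  classical
  have hC : 0 < Fintype.card C := Fintype.card_pos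
  set W := C × (Fin m → Fin K → V) × (Fin m → Fin K → V)
  set bad : W → Finset (Sym2 V → C) := fun w =>
    if LetterDisjoint w.2.1 w.2.2 then
      univ.filter fun f => ∀ q ∈ (univ : Finset (Fin m × Fin m)),
        ∃ e ∈ univ.image (fun l => s(w.2.1 q.1 l, w.2.2 q.2 l)), f e ≠ w.1
    else ∅ with hbad
  set X : ℝ := (1 - ((Fintype.card C : ℝ) ^ K)⁻¹) ^ (m * m) *
    (Fintype.card C : ℝ) ^ Fintype.card (Sym2 V) with hX
  have hC1 : (1 : ℝ) ≤ (Fintype.card C : ℝ) ^ K := one_le_pow₀ (by exact_mod_cast hC)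
  have h2 : 0 ≤ 1 - ((Fintype.card C : ℝ) ^ K)⁻¹ := sub_nonneg.2 (inv_le_one_of_one_le₀ hC1)
  have hbad_le : ∀ w, (#(bad w) : ℝ) ≤ X := by
    intro w
    by_cases hw : LetterDisjoint w.2.1 w.2.2
    · have := card_filter_forall_exists_ne_le (E := Sym2 V) w.1
        (fun q : Fin m × Fin m => univ.image (fun l => s(w.2.1 q.1 l, w.2.2 q.2 l))) K univ
        (fun q _ => card_image_le.trans (by simp)) (by
          -- A common pair would give equal indices or, if matched crosswise, a letter shared by `u`
          -- and `v`.
          intro q _ q' _ hne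
          rw [disjoint_left]
          intro e he he'
          simp only [mem_image, mem_univ, true_and] at he he'
          obtain ⟨l, rfl⟩ := he
          obtain ⟨l', hl'⟩ := he'
          rw [Sym2.eq_iff] at hl'
          rcases hl' with ⟨h1, h2⟩ | ⟨h1, h2⟩
          · exact hne (Prod.ext (hw.1 _ _ _ _ h1.symm) (hw.2.1 _ _ _ _ h2.symm))
          · exact hw.2.2 _ _ _ _ h1)
      simpa [hbad, hw, hX] using this
    · simp only [hbad, hw, if_false, card_empty, Nat.cast_zero]
      positivity
  have hcardW : (Fintype.card W : ℝ) =
      (Fintype.card C : ℝ) * (Fintype.card V : ℝ) ^ (2 * K * m) := by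
    simp only [W, Fintype.card_prod, Fintype.card_pi, prod_const, card_univ, Fintype.card_fin]
    push_cast
    ring
  have hlt : (#(univ.biUnion bad) : ℝ) < Fintype.card (Sym2 V → C) := by
    calc (#(univ.biUnion bad) : ℝ) ≤ ∑ w, (#(bad w) : ℝ) := by exact_mod_cast card_biUnion_le
      _ ≤ ∑ _w : W, X := sum_le_sum fun w _ => hbad_le w
      _ = Fintype.card W * X := by simp
      _ = (Fintype.card C : ℝ) * (Fintype.card V : ℝ) ^ (2 * K * m) *
          (1 - ((Fintype.card C : ℝ) ^ K)⁻¹) ^ (m * m) *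
          (Fintype.card C : ℝ) ^ Fintype.card (Sym2 V) := by rw [hcardW, hX]; ring
      _ < 1 * (Fintype.card C : ℝ) ^ Fintype.card (Sym2 V) := by
          gcongr
      _ = _ := by simp [Fintype.card_pi]
  obtain ⟨c, hc⟩ : ∃ c, c ∉ univ.biUnion bad := by
    by_contra! hall
    have : univ.biUnion bad = univ := eq_univ_of_forall hall
    rw [this, card_univ] at hlt
    exact lt_irrefl _ hlt
  refine ⟨c, fun t u v huv => ?_⟩
  by_contra! hcon
  refine hc (mem_biUnion.2 ⟨(t, u, v), mem_univ _, ?_⟩)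
  simpa [hbad, huv] using hcon

/-! ### Families of words avoiding a colour -/

open Finset in
/-- Words that pairwise differ in a coordinate with colour other than `t` are few. -/
theorem card_le_of_forall_letterDisjoint {ι V C : Type*} [Fintype ι] [DecidableEq ι]
    [DecidableEq V] {c : Sym2 V → C} {t : C} {m K : ℕ}
    (hc : ∀ u v : Fin m → Fin K → V, LetterDisjoint u v → ∃ x y, ∀ l, c s(u x l, v y l) = t)
    (hι : Fintype.card ι ≤ K) (P : Finset ι) (S : Finset (ι → V))
    (hagree : ∀ w ∈ S, ∀ w' ∈ S, ∀ l ∉ P, w l = w' l)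
    (hS : ∀ w ∈ S, ∀ w' ∈ S, w ≠ w' → ∃ l, w l ≠ w' l ∧ c s(w l, w' l) ≠ t) :
    #S ≤ (K * (2 * m * K)) ^ #P := by
  classical
  induction hn : #P generalizing P S with
  | zero =>
    rw [card_eq_zero] at hn
    subst hn
    rw [pow_zero, card_le_one]
    exact fun w hw w' hw' => funext fun l => hagree w hw w' hw' l (notMem_empty l)
  | succ n ih =>
    have hPK : #P ≤ K := (card_le_univ P).trans hι
    -- `hc` concerns words of length exactly `K`: coordinates in `P` are repeated to fill them.
    obtain ⟨p, hp⟩ : ∃ p : Fin K → P, Function.Surjective p := by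
      have hne : P.Nonempty := card_pos.1 (by omega)
      have : Nonempty P := hne.to_subtype
      obtain ⟨g⟩ : Nonempty (P ↪ Fin K) := Function.Embedding.nonempty_of_card_le (by simpa)
      exact ⟨Function.invFun g, Function.invFun_surjective g.injective⟩
    obtain ⟨T, hT, hmax⟩ := exists_max_image
      ({T ∈ S.powerset | ∀ w ∈ T, ∀ w' ∈ T, w ≠ w' → ∀ l ∈ P, ∀ l' ∈ P, w l ≠ w' l'}) card
      ⟨∅, by simp⟩
    simp only [mem_filter, mem_powerset] at hT hmax
    obtain ⟨hTS, hTd⟩ := hT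
    -- Otherwise two halves of `m` words each contain a pair joined in colour `t` on all of `P`,
    -- against `hS`.
    have hTcard : #T < 2 * m := by
      by_contra! hge
      obtain ⟨g⟩ : Nonempty (Fin m ⊕ Fin m ↪ T) :=
        Function.Embedding.nonempty_of_card_le (by simpa [two_mul] using hge)
      have hg : ∀ a b, ∀ l ∈ P, ∀ l' ∈ P, (g a : ι → V) l = (g b : ι → V) l' → a = b := by
        intro a b l hl l' hl' hab
        by_contra hne
        exact hTd _ (g a).2 _ (g b).2 (fun h => hne (g.injective (Subtype.ext h))) l hl l' hl' hab
      obtain ⟨x, y, hxy⟩ := hc (fun x l => (g (.inl x) : ι → V) (p l))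
        (fun y l => (g (.inr y) : ι → V) (p l))
        ⟨fun x x' l l' h => Sum.inl_injective (hg _ _ _ (p l).2 _ (p l').2 h),
          fun x x' l l' h => Sum.inr_injective (hg _ _ _ (p l).2 _ (p l').2 h),
          fun x y l l' h => Sum.inl_ne_inr (hg _ _ _ (p l).2 _ (p l').2 h)⟩
      have hne : (g (.inl x) : ι → V) ≠ g (.inr y) := fun h =>
        Sum.inl_ne_inr (g.injective (Subtype.ext h))
      obtain ⟨l, hl, hl'⟩ := hS _ (hTS (g (.inl x)).2) _ (hTS (g (.inr y)).2) hne
      by_cases hlP : l ∈ P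
      · obtain ⟨i, hi⟩ := hp ⟨l, hlP⟩
        have := hxy i
        rw [hi] at this
        exact hl' this
      · exact hl (hagree _ (hTS (g (.inl x)).2) _ (hTS (g (.inr y)).2) l hlP)
    set L : Finset V := T.biUnion fun w => P.image w with hL
    have hLcard : #L ≤ 2 * m * K := by
      calc #L ≤ #T * K := card_biUnion_le_card_mul _ _ _ fun w _ => card_image_le.trans hPK
        _ ≤ 2 * m * K := Nat.mul_le_mul_right _ hTcard.le
    -- By maximality each word shares a letter with `T`; fixing that letter frees one coordinate
    -- fewer.
    have hcover : S ⊆ (P ×ˢ L).biUnion fun q => {w ∈ S | w q.1 = q.2} := by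
      intro w hw
      suffices ∃ l ∈ P, w l ∈ L by
        obtain ⟨l, hl, hwl⟩ := this
        exact mem_biUnion.2 ⟨(l, w l), mem_product.2 ⟨hl, hwl⟩, mem_filter.2 ⟨hw, rfl⟩⟩
      by_contra! hno
      obtain ⟨l₀, hl₀⟩ : P.Nonempty := card_pos.1 (by omega)
      have hwT : w ∉ T := fun h =>
        hno l₀ hl₀ (mem_biUnion.2 ⟨w, h, mem_image_of_mem _ hl₀⟩)
      have hwd : ∀ w' ∈ T, ∀ l ∈ P, ∀ l' ∈ P, w l ≠ w' l' := fun w' hw' l hl l' hl' h =>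
        hno l hl (mem_biUnion.2 ⟨w', hw', h ▸ mem_image_of_mem _ hl'⟩)
      have := hmax (insert w T) ⟨insert_subset hw hTS, by
        intro a ha b hb hab l hl l' hl'
        rcases mem_insert.1 ha with rfl | ha' <;> rcases mem_insert.1 hb with rfl | hb'
        · exact absurd rfl hab
        · exact hwd b hb' l hl l' hl'
        · exact (hwd a ha' l' hl' l hl).symm
        · exact hTd a ha' b hb' hab l hl l' hl'⟩
      rw [card_insert_of_notMem hwT] at this
      omega
    calc #S ≤ #(P ×ˢ L) * (K * (2 * m * K)) ^ n := by
          refine (card_le_card hcover).trans (card_biUnion_le_card_mul _ _ _ ?_)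
          rintro ⟨l, a⟩ hq
          have hl := (mem_product.1 hq).1
          refine ih (P.erase l) _ ?_ ?_ (by rw [card_erase_of_mem hl, hn]; rfl)
          · intro w hw w' hw' i hi
            rw [mem_filter] at hw hw'
            by_cases h : i = l
            · rw [h, hw.2, hw'.2]
            · exact hagree w hw.1 w' hw'.1 i fun hiP => hi (mem_erase.2 ⟨h, hiP⟩)
          · exact fun w hw w' hw' => hS w (mem_filter.1 hw).1 w' (mem_filter.1 hw').1
      _ ≤ K * (2 * m * K) * (K * (2 * m * K)) ^ n := by
          rw [card_product]
          gcongr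
      _ = _ := by ring
-- Choice of sizes
/-- Sizes for which the union bound of `exists_coloring_forall_letterDisjoint` applies to `n ^ D`
letters while the resulting bound on independent sets is at most `n`. -/
theorem exists_size_union_bound (M K D T : ℕ) (hM : 1 ≤ M) :
    ∃ n m : ℕ, 2 ≤ n ∧ 1 ≤ m ∧ T ≤ n ∧ (K * (2 * m * K)) ^ K ≤ n ∧
      (M : ℝ) * ((n ^ D : ℕ) : ℝ) ^ (2 * K * m) * (1 - ((M : ℝ) ^ K)⁻¹) ^ (m * m) < 1 := by
  set r : ℝ := 1 - ((M : ℝ) ^ K)⁻¹ with hr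
  have hMK : (1 : ℝ) ≤ (M : ℝ) ^ K := one_le_pow₀ (by exact_mod_cast hM)
  have hr0 : 0 ≤ r := sub_nonneg.2 (inv_le_one_of_one_le₀ hMK)
  have hr1 : r < 1 := sub_lt_self _ (by positivity)
  obtain ⟨R, hR⟩ := exists_pow_lt_of_lt_one (y := r) (show (0 : ℝ) < 1 / 2 by norm_num) hr1
  have hR0 : 1 ≤ R := by
    rcases Nat.eq_zero_or_pos R with rfl | h
    · norm_num at hR
    · exact h
  -- With `n = 2 ^ l` and `m = R * a * l`, the probability is at most `2 ^ (-(a * l * m))`: the part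
  -- `2 * K * D` of `a` cancels the count of words, and `M + 1` beats the factor `M`.
  set a := 2 * K * D + M + 1 with ha
  have hlim := (isLittleO_pow_const_const_pow_of_one_lt (R := ℝ) K (one_lt_two)).bound
    (show (0 : ℝ) < 1 / ((K * (2 * (R * a) * K) : ℕ) ^ K + 1 : ℝ) by positivity)
  obtain ⟨l, hl, hlT⟩ := (hlim.and (Filter.eventually_ge_atTop (T + 1))).exists
  refine ⟨2 ^ l, R * a * l, ?_, ?_, ?_, ?_, ?_⟩
  · exact Nat.le_self_pow (by omega) 2
  · have : 1 ≤ l := by omega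
    have : 1 ≤ a := by omega
    have := Nat.mul_pos (Nat.mul_pos hR0 this) ‹1 ≤ l›
    exact this
  · exact (by omega : T ≤ l).trans Nat.lt_two_pow_self.le
  · rw [Real.norm_of_nonneg (by positivity), Real.norm_of_nonneg (by positivity), div_mul_eq_mul_div,
      one_mul, le_div_iff₀ (by positivity)] at hl
    have h1 : ((K * (2 * (R * a) * K) : ℕ) : ℝ) ^ K * (l : ℝ) ^ K ≤ 2 ^ l := by
      refine le_trans ?_ hl
      nlinarith [show (0 : ℝ) ≤ (l : ℝ) ^ K by positivity]
    have h2 : (K * (2 * (R * a * l) * K)) ^ K = (K * (2 * (R * a) * K)) ^ K * l ^ K := by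
      rw [← mul_pow]; ring
    rw [h2]
    exact_mod_cast h1
  · set m := R * a * l with hm
    have hm1 : 1 ≤ m := by
      have : 1 ≤ l := by omega
      have : 1 ≤ a := by omega
      exact Nat.mul_pos (Nat.mul_pos hR0 this) ‹1 ≤ l›
    have h1 : r ^ (m * m) ≤ (1 / 2) ^ (a * l * m) := by
      rw [show m * m = R * (a * l * m) by rw [hm]; ring, pow_mul]
      exact pow_le_pow_left₀ (by positivity) hR.le _
    have h2 : a * l * m = l * D * (2 * K * m) + (M + 1) * (l * m) := by rw [ha]; ring
    have h3 : M + 1 ≤ (M + 1) * (l * m) :=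
      Nat.le_mul_of_pos_right _ (Nat.mul_pos (by omega) hm1)
    have hM2 : (M : ℝ) < 2 ^ (M + 1) := by
      exact_mod_cast Nat.lt_two_pow_self.trans (Nat.pow_lt_pow_right one_lt_two (Nat.lt_succ_self M))
    have h4 : (2 : ℝ) ^ (M + 1) ≤ 2 ^ ((M + 1) * (l * m)) := pow_le_pow_right₀ (by norm_num) h3
    calc (M : ℝ) * (((2 ^ l) ^ D : ℕ) : ℝ) ^ (2 * K * m) * r ^ (m * m)
        ≤ (M : ℝ) * (((2 ^ l) ^ D : ℕ) : ℝ) ^ (2 * K * m) * (1 / 2) ^ (a * l * m) := by gcongr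
      _ = (M : ℝ) * (1 / 2) ^ ((M + 1) * (l * m)) := by
          rw [h2, pow_add]
          push_cast
          rw [← pow_mul, ← pow_mul, mul_assoc, ← mul_assoc (2 ^ _), ← mul_assoc l D, ← mul_pow]
          norm_num
      _ < 1 := by
          rw [one_div, inv_pow, mul_inv_lt_iff₀ (by positivity)]
          linarith

/-! ### Invariance under isomorphism -/

namespace SimpleGraph

open Finset

theorem Iso.isNIndepSet_map {V W : Type*} {G : SimpleGraph V} {H : SimpleGraph W} (e : G ≃g H)
    {n : ℕ} {S : Finset V} (hS : G.IsNIndepSet n S) :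
    H.IsNIndepSet n (S.map e.toEquiv.toEmbedding) := by
  refine ⟨?_, by rw [card_map, hS.card_eq]⟩
  intro x hx y hy hxy
  simp only [coe_map, Set.mem_image] at hx hy
  obtain ⟨x, hx, rfl⟩ := hx
  obtain ⟨y, hy, rfl⟩ := hy
  exact fun h => hS.isIndepSet hx hy (fun h' => hxy (by rw [h'])) (e.map_adj_iff.1 h)

theorem Iso.indepNum_eq {V W : Type*} {G : SimpleGraph V} {H : SimpleGraph W} (e : G ≃g H) :
    G.indepNum = H.indepNum := by
  unfold indepNum
  congr 1
  ext n
  exact ⟨fun ⟨_, hS⟩ => ⟨_, e.isNIndepSet_map hS⟩, fun ⟨_, hS⟩ => ⟨_, e.symm.isNIndepSet_map hS⟩⟩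

/-- Isomorphic graphs have isomorphic strong powers. -/
def Iso.strongPow {V W : Type*} {G : SimpleGraph V} {H : SimpleGraph W} (e : G ≃g H) (k : ℕ) :
    G.strongPow k ≃g H.strongPow k where
  toEquiv := Equiv.arrowCongr (Equiv.refl _) e.toEquiv
  map_rel_iff' := by
    intro u v
    have (i : Fin k) : e (u i) = e (v i) ↔ u i = v i := e.injective.eq_iff
    have h (i : Fin k) : H.Adj (e (u i)) (e (v i)) ↔ G.Adj (u i) (v i) := e.map_adj_iff
    simp [SimpleGraph.strongPow, funext_iff, this, h]

theorem Iso.indepSeries_eq {V W : Type*} {G : SimpleGraph V} {H : SimpleGraph W} (e : G ≃g H)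
    (k : ℕ) : G.indepSeries k = H.indepSeries k := by
  rw [indepSeries, indepSeries, (e.strongPow k).indepNum_eq]

/-! ### The layered graph -/

section Layered

variable {s B N : ℕ} {size : Fin s → ℕ}

/-- The vertex `⟨j, t, a⟩` is the `a`-th vertex of the `t`-th copy in layer `j`. -/
abbrev LayerVertex (B : ℕ) {s : ℕ} (size : Fin s → ℕ) : Type :=
  Σ j : Fin s, Fin B × Fin (size j)

/-- The letter of a vertex. -/
def LayerVertex.letter (hsize : ∀ j, size j ≤ N) (p : LayerVertex B size) : Fin N :=
  Fin.castLE (hsize p.1) p.2.2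

theorem LayerVertex.ext_letter (hsize : ∀ j, size j ≤ N) {p q : LayerVertex B size}
    (h1 : p.1 = q.1) (h2 : p.2.1 = q.2.1) (h3 : p.letter hsize = q.letter hsize) : p = q := by
  obtain ⟨j, t, a⟩ := p
  obtain ⟨j', t', a'⟩ := q
  obtain rfl : j = j' := h1
  obtain rfl : t = t' := h2
  obtain rfl : a = a' := Fin.castLE_injective _ h3
  rfl

/-- Vertices in different copies are adjacent. Two vertices of the `t`-th copy in layer `j` are
adjacent unless the colour of their letters, truncated to the first `ν j` colours, is `t`. -/
def layeredGraph (hsize : ∀ j, size j ≤ N) (c : Sym2 (Fin N) → Fin B) (ν : Fin s → ℕ) :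
    SimpleGraph (LayerVertex B size) where
  Adj p q := p ≠ q ∧ (p.1 = q.1 → p.2.1 = q.2.1 →
    min (c s(p.letter hsize, q.letter hsize) : ℕ) (ν p.1 - 1) ≠ p.2.1)
  symm := ⟨fun p q h => ⟨h.1.symm, fun h1 h2 => by
    rw [Sym2.eq_swap, congrArg ν h1, h2]; exact h.2 h1.symm h2.symm⟩⟩
  loopless := ⟨fun _ h => h.1 rfl⟩

variable (hsize : ∀ j, size j ≤ N) (c : Sym2 (Fin N) → Fin B) (ν : Fin s → ℕ)

/-- Truncation to `ν j` colours ensures that one of the `ν j` coordinates carries the colour of any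
given pair. -/
theorem le_indepNum_strongPow_layeredGraph {j : Fin s} (hpos : 1 ≤ ν j) (hB : ν j ≤ B) :
    size j ≤ ((layeredGraph hsize c ν).strongPow (ν j)).indepNum := by
  classical
  set w : Fin (size j) → Fin (ν j) → LayerVertex B size :=
    fun a l => ⟨j, Fin.castLE hB l, a⟩ with hw
  have hinj : Function.Injective w := by
    intro a b h
    have := congrFun h ⟨0, hpos⟩
    simpa [hw] using this
  have hind : ((layeredGraph hsize c ν).strongPow (ν j)).IsIndepSet
      ((univ.image w : Finset _) : Set (Fin (ν j) → LayerVertex B size)) := by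
    intro x hx y hy hxy hadj
    simp only [coe_image, coe_univ, Set.image_univ, Set.mem_range] at hx hy
    obtain ⟨a, rfl⟩ := hx
    obtain ⟨b, rfl⟩ := hy
    have hlt : min (c s(Fin.castLE (hsize j) a, Fin.castLE (hsize j) b) : ℕ) (ν j - 1) < ν j := by
      omega
    rcases hadj.2 ⟨_, hlt⟩ with h | h
    · exact hxy (by simp only [hw, Sigma.mk.injEq, heq_eq_eq, Prod.mk.injEq, true_and] at h; rw [h])
    · exact h.2 rfl rfl rfl
  have := hind.card_le_indepNum
  rwa [card_image_of_injective _ hinj, card_univ, Fintype.card_fin] at this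

/-- The independent set is split by `key`; the letters of each fibre form a family to which `hb`
applies. -/
theorem indepNum_strongPow_layeredGraph_le (hν : Monotone ν) {i : Fin s} {k X b : ℕ}
    (hk : k < ν i) (hB : ν i ≤ B) (hX : 1 ≤ X) (hsizeX : ∀ j < i, size j ≤ X)
    (hb : ∀ t, ∀ S : Finset (Fin k → Fin N), (∀ w ∈ S, ∀ w' ∈ S, w ≠ w' →
      ∃ l, w l ≠ w' l ∧ c s(w l, w' l) ≠ t) → #S ≤ b) :
    ((layeredGraph hsize c ν).strongPow k).indepNum ≤ b * (s * B * X) ^ k := by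
  classical
  obtain ⟨I, hI⟩ := ((layeredGraph hsize c ν).strongPow k).exists_isNIndepSet_indepNum
  rw [← hI.card_eq]
  -- The default `0` is harmless: letters from layers below `i` are less than `X`, and only these
  -- must be recovered.
  set key : (Fin k → LayerVertex B size) → (Fin k → Fin s × Fin B × Fin X) := fun w l =>
    ((w l).1, (w l).2.1, if h : ((w l).2.2 : ℕ) < X then ⟨(w l).2.2, h⟩ else ⟨0, hX⟩) with hkey
  have hcard : #(univ : Finset (Fin k → Fin s × Fin B × Fin X)) = (s * B * X) ^ k := by
    simp [mul_assoc]
  rw [← hcard]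
  refine card_le_mul_card_image_of_maps_to (f := key) (fun _ _ => mem_univ _) _ fun κ _ => ?_
  obtain ⟨t₀, ht₀, ht₀'⟩ : ∃ t₀ ∈ range (ν i), t₀ ∉ univ.image fun l => ((κ l).2.1 : ℕ) := by
    by_contra! hall
    have h1 := card_le_card (show range (ν i) ⊆ _ from hall)
    have h2 : #(univ.image fun l => ((κ l).2.1 : ℕ)) ≤ k := card_image_le.trans (by simp)
    rw [card_range] at h1
    omega
  simp only [mem_range, mem_image, mem_univ, true_and, not_exists] at ht₀ ht₀'
  have hfib {w w' : Fin k → LayerVertex B size} (hw : key w = κ) (hw' : key w' = κ) (l : Fin k) :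
      (w l).1 = (w' l).1 ∧ (w l).2.1 = (w' l).2.1 := by
    have := congrFun (hw.trans hw'.symm) l
    simp only [hkey, Prod.mk.injEq] at this
    exact ⟨this.1, this.2.1⟩
  rw [← card_image_of_injOn (f := fun w l => (w l).letter hsize)]
  · refine hb ⟨t₀, ht₀.trans_le hB⟩ _ ?_
    simp only [mem_image, mem_filter]
    rintro _ ⟨w, ⟨hwI, hwκ⟩, rfl⟩ _ ⟨w', ⟨hwI', hwκ'⟩, rfl⟩ hne
    have hww : w ≠ w' := fun h => hne (by rw [h])
    have hnadj := hI.isIndepSet hwI hwI' hww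
    obtain ⟨l, hl⟩ : ∃ l, ¬(w l = w' l ∨ (layeredGraph hsize c ν).Adj (w l) (w' l)) := by
      by_contra! h
      exact hnadj ⟨hww, h⟩
    rw [not_or] at hl
    obtain ⟨hl1, hl2⟩ := hl
    obtain ⟨h1, h2⟩ := hfib hwκ hwκ' l
    have hlet : (w l).letter hsize ≠ (w' l).letter hsize := fun h =>
      hl1 (LayerVertex.ext_letter hsize h1 h2 h)
    have hmin : min (c s((w l).letter hsize, (w' l).letter hsize) : ℕ) (ν (w l).1 - 1)
        = (w l).2.1 := by
      by_contra h
      exact hl2 ⟨hl1, fun _ _ => h⟩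
    refine ⟨l, hlet, fun hc => ?_⟩
    rw [hc] at hmin
    rcases lt_or_ge (w l).1 i with hji | hij
    · have hlt := (w l).2.2.2.trans_le (hsizeX _ hji)
      have hlt' := (w' l).2.2.2.trans_le (hsizeX _ (h1 ▸ hji))
      have := congrFun (hwκ.trans hwκ'.symm) l
      simp only [hkey, Prod.mk.injEq, hlt, hlt', dif_pos, Fin.mk.injEq] at this
      exact hlet (Fin.ext this.2.2)
    -- Here `t₀ ≤ ν i - 1 ≤ ν (w l).1 - 1`, so truncation keeps `t₀`, which would then be a copy
    -- index of `κ`.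
    · have := hν hij
      refine ht₀' l ?_
      rw [← hwκ]
      change ((w l).2.1 : ℕ) = t₀
      rw [← hmin]
      change min t₀ _ = t₀
      omega
  · intro w hw w' hw' h
    simp only [coe_filter, Set.mem_ofPred_eq] at hw hw'
    funext l
    obtain ⟨h1, h2⟩ := hfib hw.2 hw'.2 l
    exact LayerVertex.ext_letter hsize h1 h2 (congrFun h l)

end Layered

end SimpleGraph
-- Assembly
theorem theorem2 (s : ℕ) (ν : Fin s → ℕ) (hν_pos : ∀ i, 1 ≤ ν i) (hν : StrictMono ν)
    (ε : ℝ) (hε : 0 < ε) :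
    ∃ n : ℕ, 1 ≤ n ∧ ∃ G : SimpleGraph (Fin n),
      ∀ i : Fin s, ∀ k : ℕ, 1 ≤ k → k < ν i →
        G.indepSeries k < G.indepSeries (ν i) ^ ε := by
  classical
  rcases Nat.eq_zero_or_pos s with rfl | hs
  · exact ⟨1, le_rfl, ⊥, fun i => i.elim0⟩
  -- `B` serves both as the number of colours and as the bound on word lengths.
  set B : ℕ := ∑ j, ν j + 1 with hB
  have hνB : ∀ i, ν i ≤ B := fun i =>
    (Finset.single_le_sum (fun j _ => Nat.zero_le (ν j)) (Finset.mem_univ i)).trans (Nat.le_succ _)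
  have hB1 : 1 ≤ B := Nat.le_add_left _ _
  have : NeZero B := ⟨by omega⟩
  obtain ⟨d, hd⟩ := exists_nat_gt ((3 * B * B : ℝ) / ε + 1)
  have hd1 : 1 ≤ d := by
    have h0 : (0 : ℝ) ≤ (3 * B * B : ℝ) / ε := by positivity
    have : (1 : ℝ) < d := by linarith
    exact_mod_cast this.le
  have hdε : (3 * B * B : ℝ) < d * ε := by
    rw [← div_lt_iff₀ hε]
    linarith
  obtain ⟨n, m, hn, hm, hT, hmn, hprob⟩ := exists_size_union_bound B B (d ^ s) (s * B) hB1
  have hn0 : 0 < n := by omega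
  obtain ⟨c, hc⟩ := exists_coloring_forall_letterDisjoint
    (V := Fin (n ^ d ^ s)) (C := Fin B) m B (by simpa using hprob)
  -- The shift by one bounds all layers below `i` by `X = n ^ d ^ i`.
  set size : Fin s → ℕ := fun j => n ^ d ^ (j.val + 1) with hsize_def
  have hsize : ∀ j, size j ≤ n ^ d ^ s := fun j =>
    Nat.pow_le_pow_right hn0 (Nat.pow_le_pow_right hd1 j.2)
  set G := SimpleGraph.layeredGraph hsize c ν
  have hne : Nonempty (SimpleGraph.LayerVertex B size) :=
    ⟨⟨⟨0, hs⟩, 0, ⟨0, Nat.pow_pos hn0⟩⟩⟩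
  refine ⟨_, Fintype.card_pos, G.overFin rfl, fun i k hk1 hk => ?_⟩
  rw [← (G.overFinIso rfl).indepSeries_eq, ← (G.overFinIso rfl).indepSeries_eq]
  have hkB : k ≤ B := hk.le.trans (hνB i)
  have hdi : 1 ≤ d ^ i.val := Nat.one_le_pow _ _ hd1
  have hupper : (G.strongPow k).indepNum ≤ n ^ (3 * B * d ^ i.val) := by
    have hb : ∀ t, ∀ S : Finset (Fin k → Fin (n ^ d ^ s)), (∀ w ∈ S, ∀ w' ∈ S, w ≠ w' →
        ∃ l, w l ≠ w' l ∧ c s(w l, w' l) ≠ t) → S.card ≤ n := by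
      intro t S hS
      refine (card_le_of_forall_letterDisjoint (hc t) (by simpa) Finset.univ S
        (fun _ _ _ _ l hl => absurd (Finset.mem_univ l) hl) hS).trans (le_trans ?_ hmn)
      rw [Finset.card_univ, Fintype.card_fin]
      exact Nat.pow_le_pow_right (by positivity) hkB
    calc (G.strongPow k).indepNum ≤ n * (s * B * n ^ d ^ i.val) ^ k :=
          SimpleGraph.indepNum_strongPow_layeredGraph_le hsize c ν hν.monotone hk (hνB i)
            (Nat.one_le_pow _ _ hn0) (fun j hj => Nat.pow_le_pow_right hn0
              (Nat.pow_le_pow_right hd1 hj)) hb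
      _ ≤ n * (n * n ^ d ^ i.val) ^ B := by
          refine Nat.mul_le_mul_left _ ((Nat.pow_le_pow_left (Nat.mul_le_mul_right _ hT) _).trans
            (Nat.pow_le_pow_right (by positivity) hkB))
      _ = n ^ (1 + (1 + d ^ i.val) * B) := by ring
      _ ≤ n ^ (3 * B * d ^ i.val) := Nat.pow_le_pow_right hn0 (by nlinarith)
  have hlower : n ^ d ^ (i.val + 1) ≤ (G.strongPow (ν i)).indepNum :=
    SimpleGraph.le_indepNum_strongPow_layeredGraph hsize c ν (hν_pos i) (hνB i)
  have hn1 : (1 : ℝ) < n := by exact_mod_cast hn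
  have hνi : (0 : ℝ) < ν i := by exact_mod_cast hν_pos i
  have hνB' : (ν i : ℝ) ≤ B := by exact_mod_cast hνB i
  calc G.indepSeries k ≤ (((n ^ (3 * B * d ^ i.val) : ℕ) : ℝ)) ^ ((1 : ℝ) / k) :=
        Real.rpow_le_rpow (by positivity) (by exact_mod_cast hupper) (by positivity)
    -- The `k`-th root is simply dropped; `d` absorbs the loss.
    _ ≤ (((n ^ (3 * B * d ^ i.val) : ℕ) : ℝ)) ^ (1 : ℝ) := by
        refine Real.rpow_le_rpow_of_exponent_le (by exact_mod_cast Nat.one_le_pow _ _ hn0) ?_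
        exact div_le_one_of_le₀ (by exact_mod_cast hk1) (by positivity)
    _ = (n : ℝ) ^ (3 * B * d ^ i.val : ℝ) := by
        rw [Real.rpow_one, Nat.cast_pow, ← Real.rpow_natCast]
        push_cast
        rfl
    _ < (n : ℝ) ^ ((d : ℝ) ^ (i.val + 1) * (1 / ν i) * ε) := by
        refine Real.rpow_lt_rpow_of_exponent_lt hn1 ?_
        rw [mul_one_div, div_mul_eq_mul_div, lt_div_iff₀ hνi]
        have hpos : (0 : ℝ) < (d : ℝ) ^ i.val := by positivity
        calc (3 * B * d ^ i.val * ν i : ℝ) ≤ 3 * B * d ^ i.val * B := by gcongr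
          _ = (d : ℝ) ^ i.val * (3 * B * B) := by ring
          _ < (d : ℝ) ^ i.val * (d * ε) := by gcongr
          _ = _ := by ring
    _ = (((n ^ d ^ (i.val + 1) : ℕ) : ℝ) ^ ((1 : ℝ) / ν i)) ^ ε := by
        rw [Real.rpow_mul (by positivity), Real.rpow_mul (by positivity), Nat.cast_pow,
          ← Real.rpow_natCast (n : ℝ)]
        push_cast
        rfl
    _ ≤ G.indepSeries (ν i) ^ ε := by
        refine Real.rpow_le_rpow (by positivity) ?_ hε.le
        exact Real.rpow_le_rpow (by positivity) (by exact_mod_cast hlower) (by positivity)
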